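/- **Setting.** For an integer $d\ge 1$ equip $\mathbb R^d$ with the Euclidean norm, and for $\Delta>0$ let $\mathcal F_d(\Delta)$ be the set of continuously differentiable functions $F:\mathbb R^d\to\mathbb R$ that are bounded below with $F(0)-\inf F\le\Delta$. A *stochastic first-order oracle* for $F$ consists of a probability distribution $\mathcal D$ on a measurable space $\mathcal Z$ and a measurable map $(x,\xi)\mapsto\nabla f(x,\xi)\in\mathbb R^d$ with $\mathbb E_{\xi\sim\mathcal D}[\nabla f(x,\xi)]=\nabla F(x)$ for all $x$; it answers a query $x$ with $(F(x),\nabla f(x,\xi))$. For $p\in(1,2]$, $q\in[1,2]$, $\bar L>0$, $\sigma_1\ge 0$ let $\mathcal O(F,\bar L^q,\sigma_1^p)$ be the set of those oracles for which, for all $x,y\in\mathbb R^d$, $$\mathbb E\|\nabla f(x,\xi)-\nabla F(x)\|^p\le\sigma_1^p\qquad\text{and}\qquad \mathbb E\|\nabla f(x,\xi)-\nabla f(y,\xi)\|^q\le\bar L^q\|x-y\|^q .$$ A randomized algorithm with batch size $K\ge 1$ draws a random seed $r$ once; in each round $i=1,2,\dots$ it issues $K$ queries $x^{(i)}=(x^{(i)}_1,\dots,x^{(i)}_K)$,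 a measurable function of $r$ and of all answers of the previous rounds, and all $K$ of them are answered with one common seed $\xi^{(i)}\sim\mathcal D$; the seeds $\xi^{(1)},\xi^{(2)},\dots$ and $r$ are independent. The algorithm is *zero-respecting* if, against every $C^1$ function on $\mathbb R^d$ and every stochastic first-order oracle for it, almost surely, for every $i$, each coordinate that is nonzero in some query of round $i$ is nonzero in some stochastic gradient received in a round before $i$. Let $\mathcal A_{\rm zr}(K)$ be the set of these algorithms (on $\mathbb R^d$), let $$T_\varepsilon(A,F,O)=\inf\{T\ge 1:\ \mathbb E\|\nabla F(x^{(T)}_k)\|\le\varepsilon\text{ for some }k\le K\},$$ and $$\mathfrak m^{\rm zr}_\varepsilon(K,\bar L,\Delta,\sigma_1^p)=\sup_{d\ge1}\ \sup_{F\in\mathcal F_d(\Delta)}\ \sup_{O\in\mathcal O(F,\bar L^q,\sigma_1^p)}\ \inf_{A\in\mathcal A_{\rm zr}(K)}T_\varepsilon(A,F,O)\in\mathbb N\cup\{\infty\}.$$ **Theorem.** There is a universal constant $c_1>0$, and for every $p\in(1,2]$ a constant $c>0$ depending only on $p$, such that for all $q\in[1,2]$, $K\ge1$, $\bar L,\Delta>0$,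 $\sigma_1\ge0$ and $0<\varepsilon\le c_1\sqrt{\bar L\Delta}$, $$\mathfrak m^{\rm zr}_\varepsilon(K,\bar L,\Delta,\sigma_1^p)\ \ge\ c\left(\Big(\frac{\sigma_1}{\varepsilon}\Big)^{\frac p{p-1}}+\frac{\bar L\Delta}{\varepsilon^2}+\frac{\bar L\Delta}{\varepsilon^2}\Big(\frac{\sigma_1}{\varepsilon}\Big)^{\frac p{q(p-1)}}\right).$$ Moreover, there are a dimension $d\ge 1$, a function $F\in\mathcal F_d(\Delta)$ and an oracle $O\in\mathcal O(F,\bar L^q,\sigma_1^p)$ such that every $A\in\mathcal A_{\rm zr}(K)$ has $T_\varepsilon(A,F,O)$ at least this large. In particular, for $p=q=2$ one has $\mathfrak m^{\rm zr}_\varepsilon\ge c\,\big(\sigma_1^2/\varepsilon^2+\bar L\Delta/\varepsilon^2+\bar L\Delta\sigma_1/\varepsilon^3\big)$, the form of the bound of Arjevani et al. -/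

import Mathlib

open MeasureTheory
open scoped ENNReal Gradient

universe u

noncomputable section

namespace HeavyTail

/-- Euclidean space of dimension `d`, with the Euclidean norm. -/
abbrev E (d : ℕ) : Type := EuclideanSpace ℝ (Fin d)

/-- The function class `𝓕(Δ)`: continuously differentiable functions on `ℝ^d` that are bounded
below and satisfy `F 0 - inf F ≤ Δ`. -/
def FunctionClass (d : ℕ) (Δ : ℝ) : Set (E d → ℝ) :=
  {F | ContDiff ℝ 1 F ∧ BddBelow (Set.range F) ∧ F 0 - ⨅ x, F x ≤ Δ}

/-- The answer to one query of a first-order oracle: a function value and a gradient estimate. -/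
abbrev Answer (d : ℕ) : Type := ℝ × E d

/-- A stochastic first-order oracle for `F`: a probability law on a measurable space of seeds and
an unbiased estimator of the gradient of `F`. -/
structure StochasticOracle {d : ℕ} (F : E d → ℝ) where
  /-- the space of oracle seeds -/
  Seed : Type
  /-- its sigma-algebra -/
  [measurableSpace : MeasurableSpace Seed]
  /-- the distribution of the oracle seed -/
  law : Measure Seed
  [isProbabilityMeasure : IsProbabilityMeasure law]
  /-- the stochastic gradient at a point, for a seed -/
  grad : E d → Seed → E d
  measurable_grad : Measurable (Function.uncurry grad)
  integrable_grad : ∀ x, Integrable (grad x) law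
  unbiased : ∀ x, ∫ ξ, grad x ξ ∂law = ∇ F x

attribute [instance] StochasticOracle.measurableSpace StochasticOracle.isProbabilityMeasure

namespace StochasticOracle

variable {d : ℕ} {F : E d → ℝ}

/-- The oracle answers a query `x` with `(F x, ∇f(x, ξ))`. -/
def answer (O : StochasticOracle F) (x : E d) (ξ : O.Seed) : Answer d := (F x, O.grad x ξ)

/-- `p`-bounded central moment of the stochastic gradients, with parameter `σ`. -/
def HasBoundedCentralMoment (O : StochasticOracle F) (p σ : ℝ) : Prop :=
  ∀ x, ∫⁻ ξ, ‖O.grad x ξ - ∇ F x‖ₑ ^ p ∂O.law ≤ ENNReal.ofReal σ ^ p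

/-- `q`-weak average smoothness of the stochastic gradients, with constant `L`. -/
def IsWeaklyAverageSmooth (O : StochasticOracle F) (q L : ℝ) : Prop :=
  ∀ x y, ∫⁻ ξ, ‖O.grad x ξ - O.grad y ξ‖ₑ ^ q ∂O.law ≤ ENNReal.ofReal L ^ q * ‖x - y‖ₑ ^ q

end StochasticOracle

/-- The class of first-order oracles for `F` that have `p`-bounded central moment with parameter `σ`
and are `q`-weakly average smooth with constant `L`. -/
def OracleClass {d : ℕ} (F : E d → ℝ) (p q L σ : ℝ) : Set (StochasticOracle F) :=
  {O | O.HasBoundedCentralMoment p σ ∧ O.IsWeaklyAverageSmooth q L}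

/-- A randomized first-order algorithm on `ℝ^d` that issues a batch of `K` queries per round:
a law of a random seed drawn once at the beginning, and measurable maps which produce the batch of
the next round from all the previous answers and the seed. `query i` is used after `i` completed
rounds. -/
structure Algorithm (d K : ℕ) where
  /-- the space of the algorithm's random seeds -/
  Seed : Type u
  /-- its sigma-algebra -/
  [measurableSpace : MeasurableSpace Seed]
  /-- the distribution of the algorithm's seed -/
  law : Measure Seed
  [isProbabilityMeasure : IsProbabilityMeasure law]
  /-- the batch issued after `i` rounds, from the `i` batches of answers and the seed -/
  query : (i : ℕ) → (Fin i → Fin K → Answer d) → Seed → Fin K → E d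
  measurable_query : ∀ i, Measurable (Function.uncurry (query i))

attribute [instance] Algorithm.measurableSpace Algorithm.isProbabilityMeasure

namespace Algorithm

variable {d K : ℕ} {F : E d → ℝ}

/-- Outcomes of the interaction: the algorithm's seed, and one oracle seed per round. -/
abbrev Outcome (A : Algorithm.{u} d K) (O : StochasticOracle F) : Type u := A.Seed × (ℕ → O.Seed)

/-- The law of the interaction: the algorithm's seed and the oracle seeds of the rounds are
independent, and the latter are identically distributed. -/
def outcomeLaw (A : Algorithm.{u} d K) (O : StochasticOracle F) : Measure (A.Outcome O) :=
  A.law.prod (Measure.infinitePi fun _ : ℕ => O.law)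

/-- The batches of answers received in the first `i` rounds. In each round the same oracle seed is
shared by all the queries of the batch. -/
def history (A : Algorithm.{u} d K) (O : StochasticOracle F) (ω : A.Outcome O) :
    (i : ℕ) → Fin i → Fin K → Answer d
  | 0 => Fin.elim0
  | i + 1 => Fin.snoc (α := fun _ => Fin K → Answer d) (history A O ω i)
      (fun k => O.answer (A.query i (history A O ω i) ω.1 k) (ω.2 i))

/-- The batch of queries of round `i + 1`. -/
def iterate (A : Algorithm.{u} d K) (O : StochasticOracle F) (i : ℕ) (ω : A.Outcome O) :
    Fin K → E d :=
  A.query i (A.history O ω i) ω.1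

/-- `A` is zero-respecting: against every continuously differentiable function and every stochastic
first-order oracle for it, almost surely, a coordinate that is nonzero in some query of a round was
nonzero in some stochastic gradient received in an earlier round. -/
def IsZeroRespecting (A : Algorithm.{u} d K) : Prop :=
  ∀ F : E d → ℝ, ContDiff ℝ 1 F → ∀ O : StochasticOracle F,
    ∀ᵐ ω ∂A.outcomeLaw O, ∀ (i : ℕ) (k : Fin K) (c : Fin d), A.iterate O i ω k c ≠ 0 →
      ∃ j < i, ∃ l : Fin K, O.grad (A.iterate O j ω l) (ω.2 j) c ≠ 0

/-- Some query of the batch of round `i + 1` is an `ε`-stationary point in expectation. -/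
def IsStationaryAt (A : Algorithm.{u} d K) (O : StochasticOracle F) (ε : ℝ) (i : ℕ) : Prop :=
  ∃ k : Fin K, ∫⁻ ω, ‖∇ F (A.iterate O i ω k)‖ₑ ∂A.outcomeLaw O ≤ ENNReal.ofReal ε

/-- The first round `T ≥ 1` whose batch contains an `ε`-stationary point in expectation
(infinite if there is none). -/
def roundsToStationary (A : Algorithm.{u} d K) (O : StochasticOracle F) (ε : ℝ) : ℕ∞ :=
  ⨅ (i : ℕ) (_ : A.IsStationaryAt O ε i), ((i + 1 : ℕ) : ℕ∞)

end Algorithm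

/-- The complexity of finding `ε`-stationary points with zero-respecting algorithms that issue
batches of `K` queries: the supremum over dimensions `d ≥ 1`, functions in `𝓕(Δ)` and oracles in
the class of the infimum over zero-respecting algorithms of the number of rounds. -/
def complexity (p q : ℝ) (K : ℕ) (L Δ σ ε : ℝ) : ℕ∞ :=
  ⨆ (d : ℕ) (_ : 1 ≤ d) (F : E d → ℝ) (_ : F ∈ FunctionClass d Δ)
    (O : StochasticOracle F) (_ : O ∈ OracleClass F p q L σ),
    ⨅ (A : Algorithm.{u} d K) (_ : A.IsZeroRespecting), A.roundsToStationary O ε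

/-- The rate `(σ/ε)^(p/(p-1)) + LΔ/ε² + (LΔ/ε²) (σ/ε)^(p/(q(p-1)))`. -/
def rate (p q L Δ σ ε : ℝ) : ℝ :=
  (σ / ε) ^ (p / (p - 1)) + L * Δ / ε ^ 2 + L * Δ / ε ^ 2 * (σ / ε) ^ (p / (q * (p - 1)))

end HeavyTail

end

/-!
The hard function is a chain: a coordinate of the gradient stays zero until the coordinate before
it has become large, and the gradient has norm at least one wherever some coordinate vanishes. At
a point supported on the first `k` coordinates, the component of the gradient along coordinate `k`
is carried by a small Lipschitz field `reveal`, and the oracle answers `grad x + w • reveal x`,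
where `w` is `W - 1` with probability `1 / W` and `-1` otherwise. So the next coordinate shows up
only once in `W` rounds on average, however large the batch, as the seed is shared; a
zero-respecting algorithm needs `d W / 2` rounds before it has seen half of the `d` coordinates in
expectation. The noise `w` has `p`-th moment of order `W ^ (p - 1)`, which fixes `W` in terms of
`σ / ε`; by Minkowski's inequality it costs only a factor `W ^ (1 - 1 / q)` in the smoothness
constant, and this bounds the length `d` of the chain that fits below `Δ`.
-/

noncomputable section

namespace HeavyTail

/-! ### Piecewise quadratic functions of one variable -/

/-- Half the square of the positive part, from which the link functions of the chain are built. -/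
def halfSq (t : ℝ) : ℝ := (max t 0) ^ 2 / 2

/-- The penalty on negative coordinates. It makes the slope of a link at least one in absolute value
on all of `(-∞, 3)`, beyond the range where `ramp` has slope one. -/
def penalty (t : ℝ) : ℝ := halfSq (-t)

/-- The derivative of `penalty`. -/
def penaltyDeriv (t : ℝ) : ℝ := min t 0

/-- The switch of a link: a `C¹` monotone step from `0` on `(-∞, 1]` to `1` on `[3, ∞)`. -/
def step (t : ℝ) : ℝ := halfSq (t - 1) - 2 * halfSq (t - 2) + halfSq (t - 3)

/-- The derivative of `step`. -/
def stepDeriv (t : ℝ) : ℝ := max 0 (min (t - 1) (3 - t))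

/-- The reward of a link: a `C¹` monotone ramp from `0` on `(-∞, -1]` to `4` on `[4, ∞)`, of slope
one on `[0, 3]`. -/
def ramp (t : ℝ) : ℝ := halfSq (t + 1) - halfSq t - halfSq (t - 3) + halfSq (t - 4)

/-- The derivative of `ramp`. -/
def rampDeriv (t : ℝ) : ℝ := max 0 (min (min 1 (t + 1)) (4 - t))

theorem hasDerivAt_halfSq (t : ℝ) : HasDerivAt halfSq (max t 0) t := by
  rw [hasDerivAt_iff_isLittleO]
  refine Asymptotics.IsBigO.trans_isLittleO (g := fun s => (s - t) ^ 2) ?_ ?_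
  · refine Asymptotics.IsBigO.of_bound 1 (Filter.Eventually.of_forall fun s => ?_)
    simp only [halfSq, smul_eq_mul, Real.norm_eq_abs, one_mul, abs_pow, sq_abs]
    rw [abs_le]
    rcases le_total s 0 with hs | hs <;> rcases le_total t 0 with ht | ht <;>
      simp only [max_eq_left, max_eq_right, hs, ht] <;> constructor <;> nlinarith
  · simpa only [Real.norm_eq_abs, sq_abs] using Asymptotics.isLittleO_pow_sub_sub t one_lt_two

theorem hasDerivAt_halfSq_sub (a t : ℝ) :
    HasDerivAt (fun s => halfSq (s - a)) (max (t - a) 0) t :=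
  (hasDerivAt_halfSq (t - a)).comp_sub_const t a

theorem hasDerivAt_penalty (t : ℝ) : HasDerivAt penalty (penaltyDeriv t) t := by
  refine ((hasDerivAt_halfSq (-t)).scomp t (hasDerivAt_neg t)).congr_deriv ?_
  simp only [penaltyDeriv, smul_eq_mul]
  grind

theorem hasDerivAt_step (t : ℝ) : HasDerivAt step (stepDeriv t) t := by
  refine (((hasDerivAt_halfSq_sub 1 t).sub ((hasDerivAt_halfSq_sub 2 t).const_mul 2)).add
    (hasDerivAt_halfSq_sub 3 t)).congr_deriv ?_
  simp only [stepDeriv]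
  grind

theorem hasDerivAt_ramp (t : ℝ) : HasDerivAt ramp (rampDeriv t) t := by
  refine (((((hasDerivAt_halfSq (t + 1)).comp_add_const t 1).sub (hasDerivAt_halfSq t)).sub
    (hasDerivAt_halfSq_sub 3 t)).add (hasDerivAt_halfSq_sub 4 t)).congr_deriv ?_
  simp only [rampDeriv]
  grind

theorem norm_sub_le_of_hasDerivAt {G : Type*} [NormedAddCommGroup G] [NormedSpace ℝ G]
    {f f' : ℝ → G} {C : ℝ} (hf : ∀ t, HasDerivAt f (f' t) t) (hC : ∀ t, ‖f' t‖ ≤ C) (s t : ℝ) :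
    ‖f s - f t‖ ≤ C * |s - t| :=
  Convex.norm_image_sub_le_of_norm_hasDerivWithin_le (fun x _ => (hf x).hasDerivWithinAt)
    (fun x _ => hC x) convex_univ (Set.mem_univ t) (Set.mem_univ s)

theorem monotone_of_hasDerivAt {f f' : ℝ → ℝ} (hf : ∀ t, HasDerivAt f (f' t) t)
    (h0 : ∀ t, 0 ≤ f' t) : Monotone f :=
  monotone_of_deriv_nonneg (fun t => (hf t).differentiableAt) fun t =>
    (h0 t).trans_eq (hf t).deriv.symm

theorem penalty_nonneg (t : ℝ) : 0 ≤ penalty t := by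
  unfold penalty halfSq
  positivity

theorem penalty_zero : penalty 0 = 0 := by simp [penalty, halfSq]

theorem abs_penaltyDeriv_sub_le (s t : ℝ) : |penaltyDeriv s - penaltyDeriv t| ≤ |s - t| := by
  simp only [penaltyDeriv]
  grind

theorem stepDeriv_nonneg (t : ℝ) : 0 ≤ stepDeriv t := le_max_left _ _

theorem abs_stepDeriv_le_one (t : ℝ) : |stepDeriv t| ≤ 1 := by
  simp only [stepDeriv]
  grind

theorem stepDeriv_zero : stepDeriv 0 = 0 := by norm_num [stepDeriv]

theorem abs_stepDeriv_sub_le (s t : ℝ) : |stepDeriv s - stepDeriv t| ≤ |s - t| := by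
  simp only [stepDeriv]
  grind

theorem rampDeriv_nonneg (t : ℝ) : 0 ≤ rampDeriv t := le_max_left _ _

theorem abs_rampDeriv_le_one (t : ℝ) : |rampDeriv t| ≤ 1 := by
  simp only [rampDeriv]
  grind

theorem rampDeriv_zero : rampDeriv 0 = 1 := by norm_num [rampDeriv]

theorem abs_rampDeriv_sub_le (s t : ℝ) : |rampDeriv s - rampDeriv t| ≤ |s - t| := by
  simp only [rampDeriv]
  grind

theorem penaltyDeriv_sub_rampDeriv_le {t : ℝ} (ht : t < 3) :
    penaltyDeriv t - rampDeriv t ≤ -1 := by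
  simp only [penaltyDeriv, rampDeriv]
  grind

theorem abs_step_sub_le (s t : ℝ) : |step s - step t| ≤ |s - t| :=
  (norm_sub_le_of_hasDerivAt hasDerivAt_step abs_stepDeriv_le_one s t).trans_eq (one_mul _)

theorem abs_ramp_sub_le (s t : ℝ) : |ramp s - ramp t| ≤ |s - t| :=
  (norm_sub_le_of_hasDerivAt hasDerivAt_ramp abs_rampDeriv_le_one s t).trans_eq (one_mul _)

theorem step_of_le {t : ℝ} (ht : t ≤ 1) : step t = 0 := by
  rw [step, halfSq, halfSq, halfSq, max_eq_right (by linarith), max_eq_right (by linarith),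
    max_eq_right (by linarith)]
  norm_num

theorem step_of_ge {t : ℝ} (ht : 3 ≤ t) : step t = 1 := by
  rw [step, halfSq, halfSq, halfSq, max_eq_left (by linarith), max_eq_left (by linarith),
    max_eq_left (by linarith)]
  ring

theorem step_nonneg (t : ℝ) : 0 ≤ step t := by
  rw [← step_of_le (min_le_right t 1)]
  exact monotone_of_hasDerivAt hasDerivAt_step stepDeriv_nonneg (min_le_left t 1)

theorem step_le_one (t : ℝ) : step t ≤ 1 := by
  rw [← step_of_ge (le_max_right t 3)]
  exact monotone_of_hasDerivAt hasDerivAt_step stepDeriv_nonneg (le_max_left t 3)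

theorem abs_step_le_one (t : ℝ) : |step t| ≤ 1 :=
  (abs_of_nonneg (step_nonneg t)).trans_le (step_le_one t)

theorem ramp_of_le {t : ℝ} (ht : t ≤ -1) : ramp t = 0 := by
  rw [ramp, halfSq, halfSq, halfSq, halfSq, max_eq_right (by linarith), max_eq_right (by linarith),
    max_eq_right (by linarith), max_eq_right (by linarith)]
  norm_num

theorem ramp_of_ge {t : ℝ} (ht : 4 ≤ t) : ramp t = 4 := by
  rw [ramp, halfSq, halfSq, halfSq, halfSq, max_eq_left (by linarith), max_eq_left (by linarith),
    max_eq_left (by linarith), max_eq_left (by linarith)]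
  ring

theorem ramp_nonneg (t : ℝ) : 0 ≤ ramp t := by
  rw [← ramp_of_le (min_le_right t (-1))]
  exact monotone_of_hasDerivAt hasDerivAt_ramp rampDeriv_nonneg (min_le_left t (-1))

theorem ramp_le_four (t : ℝ) : ramp t ≤ 4 := by
  rw [← ramp_of_ge (le_max_right t 4)]
  exact monotone_of_hasDerivAt hasDerivAt_ramp rampDeriv_nonneg (le_max_left t 4)

theorem abs_ramp_le_four (t : ℝ) : |ramp t| ≤ 4 :=
  (abs_of_nonneg (ramp_nonneg t)).trans_le (ramp_le_four t)

/-! ### Sums and norms -/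

theorem sum_fin_eq_sum_fin_succ {M : Type*} [AddCancelCommMonoid M] (A : ℕ → M) {d : ℕ}
    (h : A 0 = A d) : ∑ i : Fin d, A i = ∑ i : Fin d, A (i + 1) := by
  rw [Fin.sum_univ_eq_sum_range A, Fin.sum_univ_eq_sum_range (fun n => A (n + 1))]
  have hsum := (Finset.sum_range_succ' A d).symm.trans (Finset.sum_range_succ A d)
  rw [h] at hsum
  exact (add_right_cancel hsum).symm

theorem abs_mul_sub_mul_le {R : Type*} [CommRing R] [LinearOrder R] [IsStrictOrderedRing R]
    {a a' b b' A B : R} (ha : |a| ≤ A) (hb : |b'| ≤ B) :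
    |a * b - a' * b'| ≤ A * |b - b'| + B * |a - a'| := by
  calc |a * b - a' * b'| = |a * (b - b') + b' * (a - a')| := by ring_nf
    _ ≤ |a| * |b - b'| + |b'| * |a - a'| := by
        simpa only [abs_mul] using abs_add_le (a * (b - b')) (b' * (a - a'))
    _ ≤ A * |b - b'| + B * |a - a'| := by gcongr

theorem norm_le_card_mul_of_support {ι : Type*} [Fintype ι] {w : EuclideanSpace ℝ ι}
    {S : Finset ι} {C : ℝ} (hS : ∀ i ∉ S, w i = 0) (hC : ∀ i ∈ S, |w i| ≤ C) :
    ‖w‖ ≤ S.card * C := by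
  have hsum : ∑ i, |w i| = ∑ i ∈ S, |w i| :=
    (Finset.sum_subset (Finset.subset_univ S) fun i _ hi => by rw [hS i hi, abs_zero]).symm
  calc ‖w‖ ≤ ∑ i, |w i| := by
        refine le_of_sq_le_sq ?_ (Finset.sum_nonneg fun i _ => abs_nonneg _)
        rw [EuclideanSpace.real_norm_sq_eq]
        simpa only [sq_abs] using
          Finset.sum_sq_le_sq_sum_of_nonneg (s := Finset.univ) fun i _ => abs_nonneg (w i)
    _ ≤ S.card * C := by
        rw [hsum, ← nsmul_eq_mul]
        exact Finset.sum_le_card_nsmul _ _ _ hC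

/-! ### The chain function -/

section Chain

variable {d : ℕ}

/-- The coordinates of `x` with indices shifted by one: `padded x (i + 1)` is the `i`-th coordinate.
The virtual coordinate before the first one lies in the saturated range of `step`, so that the first
link is switched on, and those after the last one in the null range of `ramp`. -/
def padded (x : E d) : ℕ → ℝ
  | 0 => 3
  | i + 1 => if h : i < d then x ⟨i, h⟩ else -1

/-- The derivative of `x ↦ padded x n`, which is a coordinate functional or zero. -/
def paddedDeriv : ℕ → E d →L[ℝ] ℝ
  | 0 => 0
  | i + 1 => if h : i < d then EuclideanSpace.proj ⟨i, h⟩ else 0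

theorem padded_succ (x : E d) (i : Fin d) : padded x (i + 1) = x i := by simp [padded]

theorem paddedDeriv_succ (x : E d) (i : Fin d) : paddedDeriv (i + 1) x = x i := by
  simp [paddedDeriv]

theorem padded_sub_padded (x y : E d) (n : ℕ) :
    padded x n - padded y n = paddedDeriv n (x - y) := by
  cases n with
  | zero => simp [padded, paddedDeriv]
  | succ n =>
    simp only [padded, paddedDeriv]
    split_ifs <;> simp

theorem hasFDerivAt_coord (x : E d) (i : Fin d) :
    HasFDerivAt (fun y : E d => y i) (EuclideanSpace.proj i : E d →L[ℝ] ℝ) x :=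
  (EuclideanSpace.proj i : E d →L[ℝ] ℝ).hasFDerivAt

theorem hasFDerivAt_padded (x : E d) (n : ℕ) :
    HasFDerivAt (fun y : E d => padded y n) (paddedDeriv n) x := by
  cases n with
  | zero => exact hasFDerivAt_const _ _
  | succ n =>
    simp only [padded, paddedDeriv]
    split_ifs with h
    · exact hasFDerivAt_coord x ⟨n, h⟩
    · exact hasFDerivAt_const _ _

theorem abs_paddedDeriv_le_norm (n : ℕ) (z : E d) : |paddedDeriv n z| ≤ ‖z‖ := by
  cases n with
  | zero => simp [paddedDeriv]
  | succ n =>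
    simp only [paddedDeriv]
    split_ifs with h
    · exact PiLp.norm_apply_le z ⟨n, h⟩
    · simp

theorem sum_paddedDeriv_sq_le (z : E d) {k : ℕ} (hk : k ≤ 2) :
    ∑ i : Fin d, paddedDeriv (i + k) z ^ 2 ≤ ‖z‖ ^ 2 := by
  calc ∑ i : Fin d, paddedDeriv (i + k) z ^ 2
      = ∑ n ∈ Finset.Ico k (d + k), paddedDeriv n z ^ 2 := by
        rw [Fin.sum_univ_eq_sum_range (fun n => paddedDeriv (n + k) z ^ 2),
          Finset.sum_Ico_eq_sum_range]
        simp only [add_tsub_cancel_right, add_comm]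
    _ ≤ ∑ n ∈ Finset.range (d + 2), paddedDeriv n z ^ 2 := by
        refine Finset.sum_le_sum_of_subset_of_nonneg (fun n hn => ?_) fun _ _ _ => sq_nonneg _
        simp only [Finset.mem_Ico, Finset.mem_range] at hn ⊢
        lia
    _ = ∑ i : Fin d, paddedDeriv (i + 1) z ^ 2 := by
        rw [Finset.sum_range_succ, Finset.sum_range_succ',
          ← Fin.sum_univ_eq_sum_range (fun n => paddedDeriv (n + 1) z ^ 2)]
        simp [paddedDeriv]
    _ = ‖z‖ ^ 2 := by simp only [paddedDeriv_succ, EuclideanSpace.real_norm_sq_eq]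

/-- The hard function: link `i` of the chain rewards a large coordinate `i` only once its
predecessor is large. -/
def chainFun (x : E d) : ℝ :=
  ∑ i : Fin d, (penalty (x i) - step (padded x i) * ramp (x i))

/-- The gradient of `chainFun`. -/
def chainGrad (x : E d) : E d :=
  WithLp.toLp 2 fun i => penaltyDeriv (x i) - step (padded x i) * rampDeriv (x i)
    - stepDeriv (x i) * ramp (padded x (i + 2))

theorem chainGrad_apply (x : E d) (i : Fin d) : chainGrad x i =
    penaltyDeriv (x i) - step (padded x i) * rampDeriv (x i)
      - stepDeriv (x i) * ramp (padded x (i + 2)) := rfl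

theorem sum_stepDeriv_mul_ramp (x z : E d) :
    ∑ i : Fin d, stepDeriv (padded x i) * paddedDeriv i z * ramp (x i)
      = ∑ i : Fin d, stepDeriv (x i) * z i * ramp (padded x (i + 2)) := by
  set A : ℕ → ℝ := fun n => stepDeriv (padded x n) * paddedDeriv n z * ramp (padded x (n + 1))
    with hA
  have hends : A 0 = A d := by simp [A, padded, paddedDeriv, ramp_of_le]
  simpa only [hA, padded_succ, paddedDeriv_succ] using sum_fin_eq_sum_fin_succ A hends

theorem hasGradientAt_chainFun (x : E d) : HasGradientAt chainFun (chainGrad x) x := by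
  rw [hasGradientAt_iff_hasFDerivAt]
  have hlink (i : Fin d) := HasFDerivAt.fun_sub
    ((hasDerivAt_penalty (x i)).comp_hasFDerivAt x (hasFDerivAt_coord x i))
    (((hasDerivAt_step (padded x i)).comp_hasFDerivAt x (hasFDerivAt_padded x i)).fun_mul
      ((hasDerivAt_ramp (x i)).comp_hasFDerivAt x (hasFDerivAt_coord x i)))
  refine (HasFDerivAt.fun_sum (u := Finset.univ) fun i _ => hlink i).congr_fderiv ?_
  ext z
  have hinner : inner ℝ (chainGrad x) z =
      ∑ i, (penaltyDeriv (x i) - step (padded x i) * rampDeriv (x i)) * z i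
        - ∑ i, stepDeriv (x i) * z i * ramp (padded x (i + 2)) := by
    rw [← Finset.sum_sub_distrib, PiLp.inner_apply]
    refine Finset.sum_congr rfl fun i _ => ?_
    rw [chainGrad_apply, RCLike.inner_apply, conj_trivial]
    ring
  rw [InnerProductSpace.toDual_apply_apply, hinner, ← sum_stepDeriv_mul_ramp,
    ← Finset.sum_sub_distrib, _root_.sum_apply]
  refine Finset.sum_congr rfl fun i _ => ?_
  simp only [Function.comp_def, _root_.sub_apply, _root_.add_apply, _root_.smul_apply,
    smul_eq_mul, PiLp.proj_apply]
  ring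

theorem abs_chainGrad_sub_le (x y : E d) (i : Fin d) :
    |chainGrad x i - chainGrad y i| ≤ |paddedDeriv i (x - y)| +
      6 * |paddedDeriv (i + 1) (x - y)| + |paddedDeriv (i + 2) (x - y)| := by
  simp only [← padded_sub_padded, padded_succ, chainGrad_apply]
  have hpenalty := abs_penaltyDeriv_sub_le (x i) (y i)
  have hstep_mul := abs_mul_sub_mul_le (b := rampDeriv (x i)) (a' := step (padded y i))
    (abs_step_le_one (padded x i)) (abs_rampDeriv_le_one (y i))
  have hmul_ramp := abs_mul_sub_mul_le (b := ramp (padded x (i + 2))) (a' := stepDeriv (y i))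
    (abs_stepDeriv_le_one (x i)) (abs_ramp_le_four (padded y (i + 2)))
  have hrampDeriv := abs_rampDeriv_sub_le (x i) (y i)
  have hstep := abs_step_sub_le (padded x i) (padded y i)
  have hstepDeriv := abs_stepDeriv_sub_le (x i) (y i)
  have hramp := abs_ramp_sub_le (padded x (i + 2)) (padded y (i + 2))
  rw [abs_le] at hpenalty hstep_mul hmul_ramp ⊢
  constructor <;> linarith

theorem add_six_mul_add_sq_le (a b c : ℝ) :
    (a + 6 * b + c) ^ 2 ≤ 8 * (a ^ 2 + 6 * b ^ 2 + c ^ 2) := by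
  nlinarith [sq_nonneg (a - b), sq_nonneg (c - b), sq_nonneg (a - c)]

theorem norm_chainGrad_sub_le (x y : E d) : ‖chainGrad x - chainGrad y‖ ≤ 8 * ‖x - y‖ := by
  refine le_of_sq_le_sq ?_ (by positivity)
  calc ‖chainGrad x - chainGrad y‖ ^ 2
      ≤ ∑ i : Fin d, 8 * (paddedDeriv (i + 0) (x - y) ^ 2 + 6 * paddedDeriv (i + 1) (x - y) ^ 2
        + paddedDeriv (i + 2) (x - y) ^ 2) := by
        rw [EuclideanSpace.real_norm_sq_eq]
        refine Finset.sum_le_sum fun i _ => ?_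
        rw [PiLp.sub_apply, ← sq_abs]
        refine (pow_le_pow_left₀ (abs_nonneg _) (abs_chainGrad_sub_le x y i) 2).trans ?_
        simpa only [sq_abs, add_zero] using add_six_mul_add_sq_le |paddedDeriv i (x - y)|
          |paddedDeriv (i + 1) (x - y)| |paddedDeriv (i + 2) (x - y)|
    _ ≤ 8 * (‖x - y‖ ^ 2 + 6 * ‖x - y‖ ^ 2 + ‖x - y‖ ^ 2) := by
        rw [← Finset.mul_sum, Finset.sum_add_distrib, Finset.sum_add_distrib, ← Finset.mul_sum]
        gcongr <;> exact sum_paddedDeriv_sq_le _ (by norm_num)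
    _ = (8 * ‖x - y‖) ^ 2 := by ring

theorem one_le_norm_chainGrad {x : E d} {j : Fin d} (hj : x j = 0) : 1 ≤ ‖chainGrad x‖ := by
  classical
  have hex : ∃ n, padded x (n + 1) < 3 := ⟨j, by rw [padded_succ, hj]; norm_num⟩
  set n := Nat.find hex
  have hnd : n < d := (Nat.find_min' hex (by rw [padded_succ, hj]; norm_num)).trans_lt j.2
  have hcur : x ⟨n, hnd⟩ < 3 := by
    rw [← padded_succ]
    exact Nat.find_spec hex
  have hprev : 3 ≤ padded x n := by
    cases hm : n with
    | zero => exact le_rfl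
    | succ m => exact not_lt.1 (Nat.find_min hex (m := m) (by lia))
  have hslope := penaltyDeriv_sub_rampDeriv_le hcur
  have hnext := mul_nonneg (stepDeriv_nonneg (x ⟨n, hnd⟩)) (ramp_nonneg (padded x (n + 2)))
  refine le_trans ?_ (PiLp.norm_apply_le (chainGrad x) ⟨n, hnd⟩)
  rw [chainGrad_apply, step_of_ge (t := padded x n) hprev, Real.norm_eq_abs, le_abs]
  right
  linarith

theorem chainFun_zero_sub_le (x : E d) : chainFun (0 : E d) - chainFun x ≤ 4 * d := by
  have hzero : chainFun (0 : E d) ≤ 0 := Finset.sum_nonpos fun i _ => by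
    rw [PiLp.zero_apply, penalty_zero]
    linarith [mul_nonneg (step_nonneg (padded (0 : E d) i)) (ramp_nonneg 0)]
  have hlower : ∑ _i : Fin d, (-4 : ℝ) ≤ chainFun x := Finset.sum_le_sum fun i _ => by
    have := mul_le_mul (step_le_one (padded x i)) (ramp_le_four (x i)) (ramp_nonneg _) zero_le_one
    linarith [penalty_nonneg (x i)]
  rw [Fin.sum_const, nsmul_eq_mul] at hlower
  linarith

/-! ### The revealing field -/

/-- `x` is supported on the first `k` coordinates, the ones that have been revealed so far. -/
def SupportedBelow (k : ℕ) (x : E d) : Prop := ∀ j : Fin d, k ≤ j → x j = 0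

theorem SupportedBelow.smul {k : ℕ} {x : E d} (hx : SupportedBelow k x) (s : ℝ) :
    SupportedBelow k (s • x) := fun j hj => by
  rw [PiLp.smul_apply, hx j hj, smul_zero]

/-- The coordinates of `x` from the `i`-th on. -/
def tailPart (i : ℕ) (x : E d) : E d := WithLp.toLp 2 fun j => if i ≤ j then x j else 0

theorem tailPart_apply (i : ℕ) (x : E d) (j : Fin d) :
    tailPart i x j = if i ≤ j then x j else 0 := rfl

theorem tailPart_sub (i : ℕ) (x y : E d) : tailPart i (x - y) = tailPart i x - tailPart i y := by
  ext j
  simp only [tailPart_apply, PiLp.sub_apply]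
  split_ifs <;> simp

theorem norm_tailPart_le (i : ℕ) (x : E d) : ‖tailPart i x‖ ≤ ‖x‖ := by
  refine le_of_sq_le_sq ?_ (norm_nonneg x)
  rw [EuclideanSpace.real_norm_sq_eq, EuclideanSpace.real_norm_sq_eq]
  refine Finset.sum_le_sum fun j _ => ?_
  rw [tailPart_apply]
  split_ifs
  · exact le_rfl
  · simpa using sq_nonneg (x j)

theorem abs_norm_tailPart_sub_le (i : ℕ) (x y : E d) :
    |‖tailPart i x‖ - ‖tailPart i y‖| ≤ ‖x - y‖ :=
  calc |‖tailPart i x‖ - ‖tailPart i y‖| ≤ ‖tailPart i x - tailPart i y‖ :=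
        abs_norm_sub_norm_le _ _
    _ = ‖tailPart i (x - y)‖ := by rw [tailPart_sub]
    _ ≤ ‖x - y‖ := norm_tailPart_le i _

/-- A Lipschitz field that carries the last nonzero coordinate of `chainGrad` while that coordinate
is being revealed. The factor `max 0 (1 - ‖tailPart i x‖)` cuts off the links that are switched on
but are no longer the last one, so that at most one coordinate of the field is nonzero and the
Lipschitz constant does not depend on the dimension. -/
def chainReveal (x : E d) : E d :=
  WithLp.toLp 2 fun i => -(step (padded x i) * max 0 (1 - ‖tailPart i x‖))

theorem chainReveal_apply (x : E d) (i : Fin d) :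
    chainReveal x i = -(step (padded x i) * max 0 (1 - ‖tailPart i x‖)) := rfl

theorem abs_cutoff_le_one (i : ℕ) (x : E d) : |max 0 (1 - ‖tailPart i x‖)| ≤ 1 := by
  rw [abs_of_nonneg (le_max_left _ _)]
  exact max_le zero_le_one (sub_le_self 1 (norm_nonneg _))

theorem chainReveal_apply_eq_zero_of_lt {x : E d} {i j : Fin d} (hij : i < j)
    (hi : chainReveal x i ≠ 0) : chainReveal x j = 0 := by
  rw [chainReveal_apply, neg_ne_zero] at hi
  have htail : ‖tailPart i x‖ < 1 := by
    by_contra! hle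
    exact right_ne_zero_of_mul hi (max_eq_left (sub_nonpos.2 hle))
  obtain ⟨n, hn⟩ : ∃ n, (j : ℕ) = n + 1 := Nat.exists_eq_add_one.2 (pos_of_gt (Fin.lt_def.1 hij))
  let m : Fin d := ⟨n, by lia⟩
  have him : (i : ℕ) ≤ m := Nat.le_of_lt_succ ((Fin.lt_def.1 hij).trans_eq hn)
  have hprev : x m ≤ 1 := by
    have hcoord := PiLp.norm_apply_le (tailPart i x) m
    rw [tailPart_apply, if_pos him, Real.norm_eq_abs] at hcoord
    exact (le_abs_self _).trans (hcoord.trans htail.le)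
  rw [chainReveal_apply, hn, show n = m from rfl, padded_succ, step_of_le hprev, zero_mul, neg_zero]

theorem card_support_chainReveal_le_one (x : E d) :
    {i | chainReveal x i ≠ 0}.toFinset.card ≤ 1 := by
  refine Finset.card_le_one.2 fun i hi j hj => ?_
  rw [Set.mem_toFinset] at hi hj
  by_contra hne
  rcases lt_or_gt_of_ne hne with hlt | hlt
  · exact hj (chainReveal_apply_eq_zero_of_lt hlt hi)
  · exact hi (chainReveal_apply_eq_zero_of_lt hlt hj)

theorem abs_chainReveal_apply_le_one (x : E d) (i : Fin d) : |chainReveal x i| ≤ 1 := by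
  rw [chainReveal_apply, abs_neg, abs_mul]
  exact mul_le_one₀ (abs_step_le_one _) (abs_nonneg _) (abs_cutoff_le_one _ _)

theorem abs_chainReveal_apply_sub_le (x y : E d) (i : Fin d) :
    |chainReveal x i - chainReveal y i| ≤ 2 * ‖x - y‖ := by
  rw [chainReveal_apply, chainReveal_apply, neg_sub_neg, abs_sub_comm]
  have hmul := abs_mul_sub_mul_le (b := max 0 (1 - ‖tailPart i x‖)) (a' := step (padded y i))
    (abs_step_le_one (padded x i)) (abs_cutoff_le_one i y)
  have hcutoff : |max 0 (1 - ‖tailPart i x‖) - max 0 (1 - ‖tailPart i y‖)| ≤ ‖x - y‖ := by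
    refine le_trans ?_ (abs_norm_tailPart_sub_le i x y)
    grind
  have hstep : |step (padded x i) - step (padded y i)| ≤ ‖x - y‖ := by
    refine (abs_step_sub_le _ _).trans ?_
    rw [padded_sub_padded]
    exact abs_paddedDeriv_le_norm _ _
  linarith

theorem norm_chainReveal_le (x : E d) : ‖chainReveal x‖ ≤ 1 :=
  calc ‖chainReveal x‖ ≤ {i | chainReveal x i ≠ 0}.toFinset.card * 1 :=
        norm_le_card_mul_of_support (by simp) fun i _ => abs_chainReveal_apply_le_one x i
    _ ≤ 1 := by
        rw [mul_one]
        exact_mod_cast card_support_chainReveal_le_one x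

theorem norm_chainReveal_sub_le (x y : E d) : ‖chainReveal x - chainReveal y‖ ≤ 4 * ‖x - y‖ := by
  set S : Finset (Fin d) :=
    {i | chainReveal x i ≠ 0}.toFinset ∪ {i | chainReveal y i ≠ 0}.toFinset with hS
  have hcard : (S.card : ℝ) ≤ 2 := by
    have hle : S.card ≤ 2 := (Finset.card_union_le _ _).trans
      (add_le_add (card_support_chainReveal_le_one x) (card_support_chainReveal_le_one y))
    exact_mod_cast hle
  have hsupport : ∀ i ∉ S, (chainReveal x - chainReveal y) i = 0 := fun i hi => by
    simp only [hS, Finset.mem_union, Set.mem_toFinset, Set.mem_ofPred_eq, not_or, not_not] at hi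
    rw [PiLp.sub_apply, hi.1, hi.2, sub_zero]
  calc ‖chainReveal x - chainReveal y‖ ≤ S.card * (2 * ‖x - y‖) :=
        norm_le_card_mul_of_support hsupport fun i _ => abs_chainReveal_apply_sub_le x y i
    _ ≤ 2 * (2 * ‖x - y‖) := by gcongr
    _ = 4 * ‖x - y‖ := by ring

theorem supportedBelow_chainReveal {k : ℕ} {x : E d} (hx : SupportedBelow k x) :
    SupportedBelow (k + 1) (chainReveal x) := fun j hj => by
  obtain ⟨n, hn⟩ : ∃ n, (j : ℕ) = n + 1 := Nat.exists_eq_add_one.2 (by lia)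
  let m : Fin d := ⟨n, by lia⟩
  rw [chainReveal_apply, hn, show n = m from rfl, padded_succ, hx m (by simp only [m]; lia),
    step_of_le zero_le_one, zero_mul, neg_zero]

theorem chainGrad_eq_chainReveal {k : ℕ} {x : E d} (hx : SupportedBelow k x) {j : Fin d}
    (hj : k ≤ j) : chainGrad x j = chainReveal x j := by
  have htail : tailPart j x = 0 := by
    ext l
    rw [tailPart_apply]
    split_ifs with hl
    · exact hx l (hj.trans hl)
    · rfl
  rw [chainGrad_apply, chainReveal_apply, hx j hj, htail, stepDeriv_zero, rampDeriv_zero]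
  simp [penaltyDeriv]

theorem norm_chainGrad_zero_le_one : ‖chainGrad (0 : E 1)‖ ≤ 1 := by
  have hentry (i : Fin 1) : |chainGrad 0 i| ≤ 1 := by
    rw [chainGrad_apply, PiLp.zero_apply, stepDeriv_zero, rampDeriv_zero]
    simpa [penaltyDeriv] using abs_step_le_one _
  simpa using norm_le_card_mul_of_support (S := Finset.univ)
    (fun i hi => absurd (Finset.mem_univ i) hi) fun i _ => hentry i

end Chain

/-! ### Zero-chains -/

/-- A zero-chain of length `d`: a function with a gradient that is `a`-Lipschitz and has norm at
least `γ` wherever a coordinate vanishes, and a `b`-Lipschitz field `reveal` that, at points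
supported on the first `k` coordinates, carries the only further coordinate of the gradient. The
function lies at most `D` below its value at the origin. -/
structure ZeroChain (d : ℕ) (a b γ D : ℝ) where
  /-- the function -/
  toFun : E d → ℝ
  /-- its gradient -/
  grad : E d → E d
  /-- the field that carries the next coordinate of the gradient -/
  reveal : E d → E d
  hasGradientAt : ∀ x, HasGradientAt toFun (grad x) x
  norm_grad_sub_le : ∀ x y, ‖grad x - grad y‖ ≤ a * ‖x - y‖
  norm_reveal_sub_le : ∀ x y, ‖reveal x - reveal y‖ ≤ b * ‖x - y‖
  norm_reveal_le : ∀ x, ‖reveal x‖ ≤ γ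
  grad_eq_reveal : ∀ {k x}, SupportedBelow k x → ∀ {j : Fin d}, k ≤ j → grad x j = reveal x j
  supportedBelow_reveal : ∀ {k x}, SupportedBelow k x → SupportedBelow (k + 1) (reveal x)
  le_norm_grad : ∀ {x} {j : Fin d}, x j = 0 → γ ≤ ‖grad x‖
  zero_sub_le : ∀ x, toFun 0 - toFun x ≤ D

/-- The chain function as a zero-chain of arbitrary length. -/
def chain (d : ℕ) : ZeroChain d 8 4 1 (4 * d) where
  toFun := chainFun
  grad := chainGrad
  reveal := chainReveal
  hasGradientAt := hasGradientAt_chainFun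
  norm_grad_sub_le := norm_chainGrad_sub_le
  norm_reveal_sub_le := norm_chainReveal_sub_le
  norm_reveal_le := norm_chainReveal_le
  grad_eq_reveal := chainGrad_eq_chainReveal
  supportedBelow_reveal := supportedBelow_chainReveal
  le_norm_grad := one_le_norm_chainGrad
  zero_sub_le := chainFun_zero_sub_le

/-- The chain of length one with a constant revealing field, for which the noise of the oracle costs
no smoothness at all. -/
def singleLink : ZeroChain 1 8 0 1 4 where
  toFun := chainFun
  grad := chainGrad
  reveal := fun _ => chainGrad 0
  hasGradientAt := hasGradientAt_chainFun
  norm_grad_sub_le := norm_chainGrad_sub_le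
  norm_reveal_sub_le := by simp
  norm_reveal_le := fun _ => norm_chainGrad_zero_le_one
  grad_eq_reveal := fun {_ x} hx j hj => by
    rw [show x = 0 from by ext i; rw [Subsingleton.elim i j]; exact hx j hj]
  supportedBelow_reveal := fun _ j hj => by lia
  le_norm_grad := one_le_norm_chainGrad
  zero_sub_le := fun x => by simpa using chainFun_zero_sub_le x

theorem norm_smul_comp_inv_smul_sub_le {V W : Type*} [NormedAddCommGroup V] [NormedSpace ℝ V]
    [NormedAddCommGroup W] [NormedSpace ℝ W] {f : V → W} {a s l : ℝ}
    (h : ∀ x y, ‖f x - f y‖ ≤ a * ‖x - y‖) (hs : 0 ≤ s) (hl : 0 ≤ l) (x y : V) :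
    ‖s • f (l⁻¹ • x) - s • f (l⁻¹ • y)‖ ≤ s * (a / l) * ‖x - y‖ :=
  calc ‖s • f (l⁻¹ • x) - s • f (l⁻¹ • y)‖ = s * ‖f (l⁻¹ • x) - f (l⁻¹ • y)‖ := by
        rw [← smul_sub, norm_smul, Real.norm_of_nonneg hs]
    _ ≤ s * (a * ‖l⁻¹ • x - l⁻¹ • y‖) := mul_le_mul_of_nonneg_left (h _ _) hs
    _ = s * (a / l) * ‖x - y‖ := by
        rw [← smul_sub, norm_smul, Real.norm_of_nonneg (inv_nonneg.2 hl)]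
        ring

namespace ZeroChain

variable {d : ℕ} {a b γ D : ℝ}

/-- The zero-chain with gradients scaled by `s` and lengths scaled by `l`. -/
def scale (C : ZeroChain d a b γ D) {s l : ℝ} (hs : 0 ≤ s) (hl : 0 < l) :
    ZeroChain d (s * (a / l)) (s * (b / l)) (s * γ) (s * l * D) where
  toFun x := s * l * C.toFun (l⁻¹ • x)
  grad x := s • C.grad (l⁻¹ • x)
  reveal x := s • C.reveal (l⁻¹ • x)
  hasGradientAt x := by
    rw [hasGradientAt_iff_hasFDerivAt]
    refine (((C.hasGradientAt (l⁻¹ • x)).hasFDerivAt.comp x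
      ((hasFDerivAt_id (𝕜 := ℝ) x).const_smul l⁻¹)).const_mul (s * l)).congr_fderiv ?_
    ext z
    simp only [ContinuousLinearMap.comp_smulₛₗ, map_inv₀, Real.ringHom_apply,
      ContinuousLinearMap.comp_id, _root_.smul_apply, InnerProductSpace.toDual_apply_apply,
      smul_eq_mul, map_smul]
    field_simp
  norm_grad_sub_le := norm_smul_comp_inv_smul_sub_le C.norm_grad_sub_le hs hl.le
  norm_reveal_sub_le := norm_smul_comp_inv_smul_sub_le C.norm_reveal_sub_le hs hl.le
  norm_reveal_le x := by
    rw [norm_smul, Real.norm_of_nonneg hs]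
    exact mul_le_mul_of_nonneg_left (C.norm_reveal_le _) hs
  grad_eq_reveal hx j hj := by
    rw [PiLp.smul_apply, PiLp.smul_apply, C.grad_eq_reveal (hx.smul l⁻¹) hj]
  supportedBelow_reveal hx := (C.supportedBelow_reveal (hx.smul l⁻¹)).smul s
  le_norm_grad {_ j} hj := by
    rw [norm_smul, Real.norm_of_nonneg hs]
    refine mul_le_mul_of_nonneg_left (C.le_norm_grad (j := j) ?_) hs
    rw [PiLp.smul_apply, hj, smul_zero]
  zero_sub_le x := by
    rw [smul_zero, ← mul_sub]
    exact mul_le_mul_of_nonneg_left (C.zero_sub_le _) (mul_nonneg hs hl.le)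

variable (C : ZeroChain d a b γ D)

theorem gradient_eq (x : E d) : ∇ C.toFun x = C.grad x := (C.hasGradientAt x).gradient

theorem continuous_grad : Continuous C.grad :=
  (LipschitzWith.of_dist_le' fun x y => by
    simpa only [dist_eq_norm] using C.norm_grad_sub_le x y).continuous

theorem continuous_reveal : Continuous C.reveal :=
  (LipschitzWith.of_dist_le' fun x y => by
    simpa only [dist_eq_norm] using C.norm_reveal_sub_le x y).continuous

theorem contDiff : ContDiff ℝ 1 C.toFun := by
  rw [contDiff_one_iff_hasFDerivAt]
  exact ⟨fun x => InnerProductSpace.toDual ℝ (E d) (C.grad x),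
    (InnerProductSpace.toDual ℝ (E d)).continuous.comp C.continuous_grad,
    fun x => (C.hasGradientAt x).hasFDerivAt⟩

theorem mem_functionClass {Δ : ℝ} (h : D ≤ Δ) : C.toFun ∈ FunctionClass d Δ := by
  have hle (x : E d) : C.toFun 0 - D ≤ C.toFun x := sub_le_comm.1 (C.zero_sub_le x)
  exact ⟨C.contDiff, ⟨C.toFun 0 - D, Set.forall_mem_range.2 hle⟩,
    (sub_le_comm.1 (le_ciInf hle)).trans h⟩

end ZeroChain

/-! ### Bernoulli noise -/

section Bernoulli

variable {W : ℝ}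

/-- A coin that shows heads, i.e. `true`, once in `W` tosses on average. -/
def coin (hW : 1 ≤ W) : Measure Bool :=
  ProbabilityTheory.bernoulliMeasure true false
    ⟨W⁻¹, inv_nonneg.2 (zero_le_one.trans hW), inv_le_one_of_one_le₀ hW⟩

instance isProbabilityMeasure_coin (hW : 1 ≤ W) : IsProbabilityMeasure (coin hW) := by
  unfold coin
  infer_instance

theorem lintegral_coin (hW : 1 ≤ W) (f : Bool → ℝ≥0∞) :
    ∫⁻ z, f z ∂coin hW = ENNReal.ofReal W⁻¹ * f true + ENNReal.ofReal (1 - W⁻¹) * f false := by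
  have hW0 : 0 ≤ W⁻¹ := inv_nonneg.2 (zero_le_one.trans hW)
  have hW1 : 0 ≤ 1 - W⁻¹ := sub_nonneg.2 (inv_le_one_of_one_le₀ hW)
  rw [coin, ProbabilityTheory.bernoulliMeasure_def, lintegral_add_measure, lintegral_smul_measure,
    lintegral_smul_measure, lintegral_dirac, lintegral_dirac, ENNReal.ofReal_eq_coe_nnreal hW0,
    ENNReal.ofReal_eq_coe_nnreal hW1]
  rfl

theorem lintegral_toNat_coin (hW : 1 ≤ W) :
    ∫⁻ z : Bool, (z.toNat : ℝ≥0∞) ∂coin hW = ENNReal.ofReal W⁻¹ := by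
  simp [lintegral_coin]

/-- The mean-zero weight that a coin toss puts on the revealing field. -/
def noise (W : ℝ) (z : Bool) : ℝ := if z then W - 1 else -1

theorem integral_noise (hW : 1 ≤ W) : ∫ z, noise W z ∂coin hW = 0 := by
  rw [coin, ProbabilityTheory.integral_bernoulliMeasure]
  simp only [noise, smul_eq_mul]
  field_simp
  simp

theorem lintegral_noise_rpow_le (hW : 1 ≤ W) {p : ℝ} (hp : 1 ≤ p) :
    ∫⁻ z, ‖noise W z‖ₑ ^ p ∂coin hW ≤ ENNReal.ofReal (2 * (1 - W⁻¹) * W ^ (p - 1)) := by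
  have hp0 : 0 ≤ p := zero_le_one.trans hp
  have : 0 < W := zero_lt_one.trans_le hW
  have hhead : 0 ≤ W - 1 := sub_nonneg.2 hW
  have htail : 0 ≤ 1 - W⁻¹ := sub_nonneg.2 (inv_le_one_of_one_le₀ hW)
  have hpow : 1 ≤ W ^ (p - 1) := Real.one_le_rpow hW (sub_nonneg.2 hp)
  have hheads : W⁻¹ * (W - 1) ^ p ≤ (1 - W⁻¹) * W ^ (p - 1) :=
    calc W⁻¹ * (W - 1) ^ p = (1 - W⁻¹) * (W - 1) ^ (p - 1) := by
          rw [← sub_add_cancel p 1, Real.rpow_add_one' hhead (by linarith), sub_add_cancel]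
          field_simp
      _ ≤ (1 - W⁻¹) * W ^ (p - 1) := by
          gcongr
          linarith
  calc ∫⁻ z, ‖noise W z‖ₑ ^ p ∂coin hW
      = ENNReal.ofReal (W⁻¹ * (W - 1) ^ p + (1 - W⁻¹)) := by
        rw [lintegral_coin, ENNReal.ofReal_add (by positivity) htail,
          ENNReal.ofReal_mul (by positivity), ← ENNReal.ofReal_rpow_of_nonneg hhead hp0,
          ← Real.enorm_of_nonneg hhead]
        simp [noise]
    _ ≤ ENNReal.ofReal (2 * (1 - W⁻¹) * W ^ (p - 1)) := by
        refine ENNReal.ofReal_le_ofReal ?_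
        linarith [le_mul_of_one_le_right htail hpow]

theorem lintegral_noise_rpow_rpow_inv_le (hW : 1 ≤ W) {q : ℝ} (hq : 1 ≤ q) :
    (∫⁻ z, ‖noise W z‖ₑ ^ q ∂coin hW) ^ (1 / q) ≤ ENNReal.ofReal (2 * W ^ (1 - 1 / q)) := by
  have hq0 : 0 < q := zero_lt_one.trans_le hq
  have hW0 : 0 < W := zero_lt_one.trans_le hW
  have htwo : (2 : ℝ) ≤ 2 ^ q := Real.self_le_rpow_of_one_le one_le_two hq
  rw [one_div, ENNReal.rpow_inv_le_iff hq0, ENNReal.ofReal_rpow_of_nonneg (by positivity) hq0.le]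
  refine (lintegral_noise_rpow_le hW hq).trans (ENNReal.ofReal_le_ofReal ?_)
  calc 2 * (1 - W⁻¹) * W ^ (q - 1) ≤ 2 ^ q * W ^ (q - 1) := by
        gcongr
        linarith [inv_pos.2 hW0]
    _ = (2 * W ^ (1 - q⁻¹)) ^ q := by
        rw [Real.mul_rpow zero_le_two (by positivity), ← Real.rpow_mul hW0.le]
        congr 2
        field_simp

theorem lintegral_add_noise_mul_rpow_le (hW : 1 ≤ W) {q : ℝ} (hq : 1 ≤ q) (A B : ℝ≥0∞) :
    (∫⁻ z, (A + ‖noise W z‖ₑ * B) ^ q ∂coin hW) ^ (1 / q) ≤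
      A + ENNReal.ofReal (2 * W ^ (1 - 1 / q)) * B := by
  have hq0 : 0 < q := zero_lt_one.trans_le hq
  calc (∫⁻ z, (A + ‖noise W z‖ₑ * B) ^ q ∂coin hW) ^ (1 / q)
      ≤ (∫⁻ _, A ^ q ∂coin hW) ^ (1 / q) +
        (∫⁻ z, (‖noise W z‖ₑ * B) ^ q ∂coin hW) ^ (1 / q) :=
        ENNReal.lintegral_Lp_add_le .of_discrete .of_discrete hq
    _ = A + (∫⁻ z, ‖noise W z‖ₑ ^ q ∂coin hW) ^ (1 / q) * B := by
        simp_rw [ENNReal.mul_rpow_of_nonneg _ _ hq0.le]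
        rw [lintegral_mul_const _ .of_discrete, lintegral_const, measure_univ, mul_one,
          ENNReal.mul_rpow_of_nonneg _ _ (one_div_nonneg.2 hq0.le), one_div,
          ENNReal.rpow_rpow_inv hq0.ne', ENNReal.rpow_rpow_inv hq0.ne']
    _ ≤ A + ENNReal.ofReal (2 * W ^ (1 - 1 / q)) * B := by
        gcongr
        exact lintegral_noise_rpow_rpow_inv_le hW hq

namespace ZeroChain

variable {d : ℕ} {a b γ D : ℝ} (C : ZeroChain d a b γ D)

/-- The oracle that adds the revealing field with a random weight: only when the coin shows heads
does the next coordinate of the gradient appear in the answer. -/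
def oracle (hW : 1 ≤ W) : StochasticOracle C.toFun where
  Seed := Bool
  law := coin hW
  grad x z := C.grad x + noise W z • C.reveal x
  measurable_grad := (C.continuous_grad.measurable.comp measurable_fst).add
    (((Measurable.of_discrete (f := noise W)).comp measurable_snd).smul
      (C.continuous_reveal.measurable.comp measurable_fst))
  integrable_grad _ := .of_finite
  unbiased x := by
    rw [integral_add .of_finite .of_finite, integral_smul_const, integral_noise, zero_smul,
      integral_const, probReal_univ, one_smul, add_zero, C.gradient_eq]

theorem oracle_grad (hW : 1 ≤ W) (x : E d) (z : Bool) :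
    (C.oracle hW).grad x z = C.grad x + noise W z • C.reveal x := rfl

include C in
theorem bound_nonneg : 0 ≤ γ := (norm_nonneg _).trans (C.norm_reveal_le 0)

theorem hasBoundedCentralMoment_oracle (hW : 1 ≤ W) {p σ : ℝ} (hp : 1 ≤ p) (hσ : 0 ≤ σ)
    (h : 2 * (1 - W⁻¹) * W ^ (p - 1) * γ ^ p ≤ σ ^ p) :
    (C.oracle hW).HasBoundedCentralMoment p σ := fun x => by
  have hp0 : 0 ≤ p := zero_le_one.trans hp
  have hγ := C.bound_nonneg
  calc ∫⁻ z, ‖C.grad x + noise W z • C.reveal x - ∇ C.toFun x‖ₑ ^ p ∂coin hW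
      = (∫⁻ z, ‖noise W z‖ₑ ^ p ∂coin hW) * ‖C.reveal x‖ₑ ^ p := by
        rw [← lintegral_mul_const _ .of_discrete]
        simp_rw [C.gradient_eq, add_sub_cancel_left, enorm_smul, ENNReal.mul_rpow_of_nonneg _ _ hp0]
    _ ≤ ENNReal.ofReal (2 * (1 - W⁻¹) * W ^ (p - 1)) * ENNReal.ofReal (γ ^ p) := by
        rw [← ENNReal.ofReal_rpow_of_nonneg hγ hp0, ← ofReal_norm (C.reveal x)]
        gcongr
        · exact lintegral_noise_rpow_le hW hp
        · exact C.norm_reveal_le x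
    _ ≤ ENNReal.ofReal σ ^ p := by
        rw [← ENNReal.ofReal_mul' (by positivity), ENNReal.ofReal_rpow_of_nonneg hσ hp0]
        exact ENNReal.ofReal_le_ofReal h

theorem enorm_oracle_grad_sub_le (hW : 1 ≤ W) (ha : 0 ≤ a) (hb : 0 ≤ b) (x y : E d) (z : Bool) :
    ‖(C.oracle hW).grad x z - (C.oracle hW).grad y z‖ₑ ≤
      ENNReal.ofReal a * ‖x - y‖ₑ + ‖noise W z‖ₑ * (ENNReal.ofReal b * ‖x - y‖ₑ) := by
  have hgrad : ‖C.grad x - C.grad y‖ₑ ≤ ENNReal.ofReal a * ‖x - y‖ₑ := by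
    simpa only [ofReal_norm, ENNReal.ofReal_mul ha] using
      ENNReal.ofReal_le_ofReal (C.norm_grad_sub_le x y)
  have hreveal : ‖C.reveal x - C.reveal y‖ₑ ≤ ENNReal.ofReal b * ‖x - y‖ₑ := by
    simpa only [ofReal_norm, ENNReal.ofReal_mul hb] using
      ENNReal.ofReal_le_ofReal (C.norm_reveal_sub_le x y)
  rw [oracle_grad, oracle_grad, add_sub_add_comm, ← smul_sub]
  refine (enorm_add_le _ _).trans ?_
  rw [enorm_smul]
  gcongr

theorem isWeaklyAverageSmooth_oracle (hW : 1 ≤ W) (ha : 0 ≤ a) (hb : 0 ≤ b) {q L : ℝ} (hq : 1 ≤ q)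
    (h : a + 2 * b * W ^ (1 - 1 / q) ≤ L) : (C.oracle hW).IsWeaklyAverageSmooth q L := by
  intro x y
  have hq0 : 0 < q := zero_lt_one.trans_le hq
  have : 0 ≤ W := zero_le_one.trans hW
  set δ := ‖x - y‖ₑ
  rw [← ENNReal.mul_rpow_of_nonneg _ _ hq0.le, ← ENNReal.rpow_inv_le_iff hq0, ← one_div]
  calc (∫⁻ z, ‖(C.oracle hW).grad x z - (C.oracle hW).grad y z‖ₑ ^ q ∂coin hW) ^ (1 / q)
      ≤ (∫⁻ z, (ENNReal.ofReal a * δ + ‖noise W z‖ₑ * (ENNReal.ofReal b * δ)) ^ q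
        ∂coin hW) ^ (1 / q) := by
        gcongr with z
        exact C.enorm_oracle_grad_sub_le hW ha hb x y z
    _ ≤ ENNReal.ofReal a * δ + ENNReal.ofReal (2 * W ^ (1 - 1 / q)) * (ENNReal.ofReal b * δ) :=
        lintegral_add_noise_mul_rpow_le hW hq _ _
    _ = ENNReal.ofReal (a + 2 * b * W ^ (1 - 1 / q)) * δ := by
        rw [← mul_assoc, ← ENNReal.ofReal_mul (by positivity), ← add_mul,
          ← ENNReal.ofReal_add ha (by positivity), mul_right_comm]
    _ ≤ ENNReal.ofReal L * δ := by gcongr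

end ZeroChain

/-! ### Progress of zero-respecting algorithms -/

namespace Algorithm

variable {d K : ℕ} {F : E d → ℝ} (A : Algorithm.{u} d K) (O : StochasticOracle F)

instance isProbabilityMeasure_outcomeLaw : IsProbabilityMeasure (A.outcomeLaw O) := by
  unfold outcomeLaw
  infer_instance

theorem measurePreserving_seed (j : ℕ) :
    MeasurePreserving (fun ω : A.Outcome O => ω.2 j) (A.outcomeLaw O) O.law :=
  (measurePreserving_eval_infinitePi (fun _ : ℕ => O.law) j).comp measurePreserving_snd

theorem measurable_seed {f : O.Seed → ℝ≥0∞} (hf : Measurable f) (j : ℕ) :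
    Measurable fun ω : A.Outcome O => f (ω.2 j) :=
  hf.comp (A.measurePreserving_seed O j).measurable

theorem lintegral_sum_seed {f : O.Seed → ℝ≥0∞} (hf : Measurable f) (i : ℕ) :
    ∫⁻ ω, ∑ j ∈ Finset.range i, f (ω.2 j) ∂A.outcomeLaw O = i * ∫⁻ z, f z ∂O.law := by
  rw [lintegral_finsetSum _ fun j _ => A.measurable_seed O hf j]
  simp only [(A.measurePreserving_seed O _).lintegral_comp hf, Finset.sum_const,
    Finset.card_range, nsmul_eq_mul]

theorem supportedBelow_iterate {n : O.Seed → ℕ}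
    (hn : ∀ {k x}, SupportedBelow k x → ∀ z, SupportedBelow (k + n z) (O.grad x z))
    {ω : A.Outcome O}
    (hω : ∀ (i : ℕ) (k : Fin K) (c : Fin d), A.iterate O i ω k c ≠ 0 →
      ∃ j < i, ∃ l : Fin K, O.grad (A.iterate O j ω l) (ω.2 j) c ≠ 0) (i : ℕ) (k : Fin K) :
    SupportedBelow (∑ j ∈ Finset.range i, n (ω.2 j)) (A.iterate O i ω k) := by
  induction i using Nat.strong_induction_on generalizing k with
  | _ i ih =>
    intro c hc
    by_contra hne
    obtain ⟨j, hji, l, hl⟩ := hω i k c hne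
    refine hl (hn (ih j hji l) (ω.2 j) c (le_trans ?_ hc))
    rw [← Finset.sum_range_succ (fun j => n (ω.2 j))]
    exact Finset.sum_le_sum_of_subset (Finset.range_subset_range.2 hji)

end Algorithm

namespace ZeroChain

variable {d : ℕ} {a b γ D : ℝ} (C : ZeroChain d a b γ D)

theorem supportedBelow_oracle_grad (hW : 1 ≤ W) {k : ℕ} {x : E d} (hx : SupportedBelow k x)
    (z : Bool) : SupportedBelow (k + z.toNat) ((C.oracle hW).grad x z) := fun j hj => by
  rw [oracle_grad, PiLp.add_apply, PiLp.smul_apply, C.grad_eq_reveal hx (by lia)]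
  cases z with
  | false => simp [noise]
  | true => rw [C.supportedBelow_reveal hx j hj, smul_zero, add_zero]

theorem mul_le_enorm_gradient_mul_add {k : ℕ} {x : E d} (hx : SupportedBelow k x) :
    ENNReal.ofReal γ * d ≤ ‖∇ C.toFun x‖ₑ * d + ENNReal.ofReal γ * k := by
  rcases lt_or_ge k d with hk | hk
  · refine le_add_right (mul_le_mul_left ?_ _)
    rw [C.gradient_eq, ← ofReal_norm]
    exact ENNReal.ofReal_le_ofReal (C.le_norm_grad (hx ⟨k, hk⟩ le_rfl))
  · exact le_add_left (by gcongr)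

theorem mul_le_lintegral_enorm_gradient_mul_add (hW : 1 ≤ W) {K : ℕ} {A : Algorithm.{u} d K}
    (hA : A.IsZeroRespecting) (i : ℕ) (k : Fin K) : ENNReal.ofReal γ * d ≤
      (∫⁻ ω, ‖∇ C.toFun (A.iterate (C.oracle hW) i ω k)‖ₑ ∂A.outcomeLaw (C.oracle hW)) * d +
        ENNReal.ofReal γ * (i * ENNReal.ofReal W⁻¹) := by
  set O := C.oracle hW
  have hprogress : ∀ᵐ ω ∂A.outcomeLaw O, ENNReal.ofReal γ * d ≤
      ‖∇ C.toFun (A.iterate O i ω k)‖ₑ * d +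
        ENNReal.ofReal γ * ∑ j ∈ Finset.range i, ((ω.2 j).toNat : ℝ≥0∞) := by
    filter_upwards [hA C.toFun C.contDiff O] with ω hω
    exact_mod_cast C.mul_le_enorm_gradient_mul_add
      (A.supportedBelow_iterate O (C.supportedBelow_oracle_grad hW) hω i k)
  have htoNat : Measurable fun z : O.Seed => ((Bool.toNat z : ℕ) : ℝ≥0∞) :=
    Measurable.of_discrete (α := Bool)
  calc ENNReal.ofReal γ * d = ∫⁻ _, ENNReal.ofReal γ * d ∂A.outcomeLaw O := by
        rw [lintegral_const, measure_univ, mul_one]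
    _ ≤ _ := lintegral_mono_ae hprogress
    _ = (∫⁻ ω, ‖∇ C.toFun (A.iterate O i ω k)‖ₑ ∂A.outcomeLaw O) * d +
          ENNReal.ofReal γ * (i * ENNReal.ofReal W⁻¹) := by
        rw [lintegral_add_right _ ((Finset.measurable_fun_sum _ fun j _ =>
            A.measurable_seed O htoNat j).const_mul _),
          lintegral_mul_const' _ _ (ENNReal.natCast_ne_top d),
          lintegral_const_mul' _ _ ENNReal.ofReal_ne_top, A.lintegral_sum_seed O htoNat,
          ← lintegral_toNat_coin hW]
        rfl

theorem le_of_isStationaryAt {ε : ℝ} (hε : 0 < ε) (hγ : 2 * ε ≤ γ) (hW : 1 ≤ W) {K : ℕ}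
    {A : Algorithm.{u} d K} (hA : A.IsZeroRespecting) {i : ℕ}
    (hi : A.IsStationaryAt (C.oracle hW) ε i) : d * W / 2 ≤ i := by
  obtain ⟨k, hk⟩ := hi
  have hW0 : 0 < W := zero_lt_one.trans_le hW
  have hγ0 : 0 < γ := lt_of_lt_of_le (by positivity) hγ
  have hmean := (C.mul_le_lintegral_enorm_gradient_mul_add hW hA i k).trans
    (add_le_add_left (mul_le_mul_left hk _) _)
  rw [← ENNReal.ofReal_natCast, ← ENNReal.ofReal_natCast, ← ENNReal.ofReal_mul (by positivity),
    ← ENNReal.ofReal_mul (by positivity), ← ENNReal.ofReal_mul (by positivity),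
    ← ENNReal.ofReal_mul (by positivity), ← ENNReal.ofReal_add (by positivity) (by positivity),
    ENNReal.ofReal_le_ofReal_iff (by positivity)] at hmean
  have hhalf : ε * d ≤ γ / 2 * d := mul_le_mul_of_nonneg_right (by linarith) d.cast_nonneg
  refine le_of_mul_le_mul_left ?_ hγ0
  calc γ * (d * W / 2) = (γ * d - γ / 2 * d) * W := by ring
    _ ≤ γ * (i * W⁻¹) * W := mul_le_mul_of_nonneg_right (by linarith) hW0.le
    _ = γ * i := by field_simp

theorem le_roundsToStationary {ε : ℝ} (hε : 0 < ε) (hγ : 2 * ε ≤ γ) (hW : 1 ≤ W) {K : ℕ}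
    {A : Algorithm.{u} d K} (hA : A.IsZeroRespecting) :
    ENNReal.ofReal (d * W / 2) ≤ A.roundsToStationary (C.oracle hW) ε := by
  simp only [Algorithm.roundsToStationary, ENat.toENNReal_iInf]
  refine le_iInf₂ fun i hi => (ENNReal.ofReal_le_ofReal
    (C.le_of_isStationaryAt hε hγ hW hA hi)).trans ?_
  rw [ENNReal.ofReal_natCast]
  exact_mod_cast Nat.le_succ i

end ZeroChain

end Bernoulli

/-! ### The choice of parameters -/

/-- The mean number of rounds per revealed coordinate, as large as the bound `σ` on the central
moments allows for revealing fields of norm `2 * ε`. -/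
def waitingTime (p σ ε : ℝ) : ℝ := max 1 ((σ / (4 * ε)) ^ (p / (p - 1)))

theorem one_le_waitingTime (p σ ε : ℝ) : 1 ≤ waitingTime p σ ε := le_max_left _ _

theorem moment_waitingTime_le {p σ ε : ℝ} (hp : 1 < p) (hσ : 0 ≤ σ) (hε : 0 < ε) :
    2 * (1 - (waitingTime p σ ε)⁻¹) * waitingTime p σ ε ^ (p - 1) * (2 * ε) ^ p ≤ σ ^ p := by
  rcases max_choice 1 ((σ / (4 * ε)) ^ (p / (p - 1))) with h | h <;> rw [← waitingTime] at h
  · simpa [h] using Real.rpow_nonneg hσ p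
  have hpow : waitingTime p σ ε ^ (p - 1) = (σ / (4 * ε)) ^ p := by
    rw [h, ← Real.rpow_mul (by positivity), div_mul_cancel₀ _ (sub_pos.2 hp).ne']
  have hinv : 0 < (waitingTime p σ ε)⁻¹ :=
    inv_pos.2 (zero_lt_one.trans_le (one_le_waitingTime p σ ε))
  have htwo : (2 : ℝ) ≤ 2 ^ p := Real.self_le_rpow_of_one_le one_le_two hp.le
  calc 2 * (1 - (waitingTime p σ ε)⁻¹) * waitingTime p σ ε ^ (p - 1) * (2 * ε) ^ p
      ≤ 2 ^ p * (σ / (4 * ε)) ^ p * (2 * ε) ^ p := by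
        rw [hpow]
        gcongr
        linarith
    _ = (2 * (σ / (4 * ε)) * (2 * ε)) ^ p := by
        rw [← Real.mul_rpow (by positivity) (by positivity),
          ← Real.mul_rpow (by positivity) (by positivity)]
    _ = σ ^ p := by
        congr 1
        field_simp
        ring

/-- In dimension `d` there are a function in `𝓕(Δ)` and an oracle in its class which keep every
zero-respecting algorithm with batches of `K` queries from `ε`-stationarity for `r` rounds. -/
def HasHardInstance (p q L Δ σ ε : ℝ) (d K : ℕ) (r : ℝ) : Prop :=
  ∃ F ∈ FunctionClass d Δ, ∃ O ∈ OracleClass F p q L σ,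
    ∀ A : Algorithm.{u} d K, A.IsZeroRespecting →
      ENNReal.ofReal r ≤ (A.roundsToStationary O ε : ℝ≥0∞)

section HardInstance

variable {p q L Δ σ ε : ℝ} {d : ℕ}

namespace HasHardInstance

variable {K : ℕ} {r r' : ℝ}

theorem mono (h : HasHardInstance.{u} p q L Δ σ ε d K r) (hr : r' ≤ r) :
    HasHardInstance.{u} p q L Δ σ ε d K r' := by
  obtain ⟨F, hF, O, hO, hA⟩ := h
  exact ⟨F, hF, O, hO, fun A hzr => (ENNReal.ofReal_le_ofReal hr).trans (hA A hzr)⟩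

theorem le_complexity (h : HasHardInstance.{u} p q L Δ σ ε d K r) (hd : 1 ≤ d) :
    ENNReal.ofReal r ≤ (complexity.{u} p q K L Δ σ ε : ℝ≥0∞) := by
  obtain ⟨F, hF, O, hO, hA⟩ := h
  refine ENat.ceil_le.1 ((le_iInf₂ fun A hzr => ENat.ceil_le.2 (hA A hzr)).trans ?_)
  exact le_iSup₂_of_le d hd <| le_iSup₂_of_le F hF <| le_iSup₂_of_le O hO le_rfl

end HasHardInstance

theorem ZeroChain.hasHardInstance {a b D : ℝ} (C : ZeroChain d a b 1 D) (ha : 0 < a) (hb : 0 ≤ b)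
    (hp : 1 < p) (hq : 1 ≤ q) (hL : 0 < L) (hσ : 0 ≤ σ) (hε : 0 < ε)
    (h : 4 * ε ^ 2 * (a + 2 * b * waitingTime p σ ε ^ (1 - 1 / q)) * D ≤ L * Δ) (K : ℕ) :
    HasHardInstance.{u} p q L Δ σ ε d K (d * waitingTime p σ ε / 2) := by
  have hW := one_le_waitingTime p σ ε
  set U := waitingTime p σ ε ^ (1 - 1 / q)
  have hU : 0 < U := Real.rpow_pos_of_pos (zero_lt_one.trans_le hW) _
  set l := 2 * ε * (a + 2 * b * U) / L with hl
  have hl0 : 0 < l := by positivity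
  have hsmooth : 2 * ε * (a / l) + 2 * (2 * ε * (b / l)) * U = L := by
    clear_value U
    rw [hl]
    field_simp
  let C' := C.scale (s := 2 * ε) (by positivity) hl0
  refine ⟨C'.toFun, C'.mem_functionClass ?_, C'.oracle hW, ⟨?_, ?_⟩, fun A hA =>
    C'.le_roundsToStationary hε (mul_one _).ge hW hA⟩
  · rw [← mul_le_mul_iff_right₀ hL]
    refine Eq.trans_le ?_ h
    rw [hl]
    field_simp
    ring
  · refine C'.hasBoundedCentralMoment_oracle hW hp.le hσ ?_
    rw [mul_one]
    exact moment_waitingTime_le hp hσ hε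
  · exact C'.isWeaklyAverageSmooth_oracle hW (by positivity) (by positivity) hq hsmooth.le

theorem hasHardInstance_chain (hp : 1 < p) (hq : 1 ≤ q) (hL : 0 < L) (hσ : 0 ≤ σ) (hε : 0 < ε)
    {T : ℕ} (h : 256 * ε ^ 2 * waitingTime p σ ε ^ (1 - 1 / q) * T ≤ L * Δ) (K : ℕ) :
    HasHardInstance.{u} p q L Δ σ ε T K (T * waitingTime p σ ε / 2) := by
  refine (chain T).hasHardInstance (by norm_num) (by norm_num) hp hq hL hσ hε (le_trans ?_ h) K
  have hU : 1 ≤ waitingTime p σ ε ^ (1 - 1 / q) :=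
    Real.one_le_rpow (one_le_waitingTime p σ ε)
      (sub_nonneg.2 (div_le_one_of_le₀ hq (zero_le_one.trans hq)))
  calc 4 * ε ^ 2 * (8 + 2 * 4 * waitingTime p σ ε ^ (1 - 1 / q)) * (4 * T)
      = 128 * ε ^ 2 * T * (1 + waitingTime p σ ε ^ (1 - 1 / q)) := by ring
    _ ≤ 128 * ε ^ 2 * T * (waitingTime p σ ε ^ (1 - 1 / q) +
          waitingTime p σ ε ^ (1 - 1 / q)) := by gcongr
    _ = 256 * ε ^ 2 * waitingTime p σ ε ^ (1 - 1 / q) * T := by ring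

theorem hasHardInstance_singleLink (hp : 1 < p) (hq : 1 ≤ q) (hL : 0 < L) (hσ : 0 ≤ σ)
    (hε : 0 < ε) (h : 128 * ε ^ 2 ≤ L * Δ) (K : ℕ) :
    HasHardInstance.{u} p q L Δ σ ε 1 K (waitingTime p σ ε / 2) := by
  simpa only [Nat.cast_one, one_mul] using
    singleLink.hasHardInstance (by norm_num) le_rfl hp hq hL hσ hε (by linarith) K

theorem exists_natCast_mul_le_and_le {k : Type*} [Field k] [LinearOrder k]
    [IsStrictOrderedRing k] [FloorSemiring k] {x y : k} (hx : 0 < x) (hxy : x ≤ y) :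
    ∃ n : ℕ, 1 ≤ n ∧ n * x ≤ y ∧ y ≤ 2 * n * x := by
  have hquot : 1 ≤ y / x := (one_le_div hx).2 hxy
  have hfloor : 1 ≤ ⌊y / x⌋₊ := Nat.le_floor (by exact_mod_cast hquot)
  have hfloor' : (1 : k) ≤ ⌊y / x⌋₊ := by exact_mod_cast hfloor
  refine ⟨⌊y / x⌋₊, hfloor, (le_div_iff₀ hx).1 (Nat.floor_le (zero_le_one.trans hquot)),
    (div_le_iff₀ hx).1 ?_⟩
  linarith [Nat.lt_floor_add_one (y / x)]

theorem exists_hasHardInstance_waitingTime (hp : 1 < p) (hq : 1 ≤ q) (hL : 0 < L) (hσ : 0 ≤ σ)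
    (hε : 0 < ε) (h : 128 * ε ^ 2 ≤ L * Δ) (K : ℕ) :
    ∃ d : ℕ, 1 ≤ d ∧ HasHardInstance.{u} p q L Δ σ ε d K
      ((waitingTime p σ ε + 2 * (L * Δ / ε ^ 2 * waitingTime p σ ε ^ (1 / q))) / 2050) := by
  set M := L * Δ / ε ^ 2 with hM
  set W := waitingTime p σ ε
  have hW0 : 0 < W := zero_lt_one.trans_le (one_le_waitingTime p σ ε)
  have hUV : W ^ (1 - 1 / q) * W ^ (1 / q) = W := by
    rw [← Real.rpow_add hW0, sub_add_cancel, Real.rpow_one]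
  rcases le_or_gt (256 * W ^ (1 - 1 / q)) M with hlarge | hsmall
  · obtain ⟨T, hT, hTM, hMT⟩ := exists_natCast_mul_le_and_le (by positivity) hlarge
    refine ⟨T, hT, (hasHardInstance_chain hp hq hL hσ hε ?_ K).mono ?_⟩
    · rw [hM, le_div_iff₀ (by positivity)] at hTM
      linarith
    · have hMW : M * W ^ (1 / q) ≤ 512 * (T * W) := by
        calc M * W ^ (1 / q) ≤ 2 * T * (256 * W ^ (1 - 1 / q)) * W ^ (1 / q) := by gcongr
          _ = 512 * (T * (W ^ (1 - 1 / q) * W ^ (1 / q))) := by ring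
          _ = 512 * (T * W) := by rw [hUV]
      linarith [le_mul_of_one_le_left hW0.le (Nat.one_le_cast (α := ℝ).2 hT)]
  · refine ⟨1, le_rfl, (hasHardInstance_singleLink hp hq hL hσ hε h K).mono ?_⟩
    have hMW : M * W ^ (1 / q) ≤ 256 * W := by
      calc M * W ^ (1 / q) ≤ 256 * W ^ (1 - 1 / q) * W ^ (1 / q) := by gcongr
        _ = 256 * W := by rw [mul_assoc, hUV]
    linarith

theorem div_rpow_le_mul_waitingTime (hσ : 0 ≤ σ) (hε : 0 < ε) :
    (σ / ε) ^ (p / (p - 1)) ≤ 4 ^ (p / (p - 1)) * waitingTime p σ ε := by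
  calc (σ / ε) ^ (p / (p - 1)) = (4 * (σ / (4 * ε))) ^ (p / (p - 1)) := by
        congr 1
        field_simp
    _ = 4 ^ (p / (p - 1)) * (σ / (4 * ε)) ^ (p / (p - 1)) :=
        Real.mul_rpow zero_le_four (by positivity)
    _ ≤ 4 ^ (p / (p - 1)) * waitingTime p σ ε := by
        gcongr
        exact le_max_right _ _

theorem rate_le (hp : 1 < p) (hq : 1 ≤ q) (hLΔ : 0 ≤ L * Δ) (hσ : 0 ≤ σ) (hε : 0 < ε) :
    rate p q L Δ σ ε ≤ 4 ^ (p / (p - 1)) *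
      (waitingTime p σ ε + 2 * (L * Δ / ε ^ 2 * waitingTime p σ ε ^ (1 / q))) := by
  have hp0 : 0 < p - 1 := sub_pos.2 hp
  have hq0 : 0 < q := zero_lt_one.trans_le hq
  have hM : 0 ≤ L * Δ / ε ^ 2 := by positivity
  have hW := one_le_waitingTime p σ ε
  have hσW := div_rpow_le_mul_waitingTime (p := p) hσ hε
  have hc : (1 : ℝ) ≤ 4 ^ (p / (p - 1)) := Real.one_le_rpow (by norm_num) (by positivity)
  have hexp : p / (q * (p - 1)) = p / (p - 1) * (1 / q) := by field_simp
  set W := waitingTime p σ ε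
  set M := L * Δ / ε ^ 2
  set c : ℝ := 4 ^ (p / (p - 1))
  have hWq : 1 ≤ W ^ (1 / q) := Real.one_le_rpow hW (by positivity)
  have hdeterministic : M ≤ c * (M * W ^ (1 / q)) :=
    (le_mul_of_one_le_right hM hWq).trans (le_mul_of_one_le_left (by positivity) hc)
  have hmixed : M * (σ / ε) ^ (p / (q * (p - 1))) ≤ c * (M * W ^ (1 / q)) := by
    calc M * (σ / ε) ^ (p / (q * (p - 1))) = M * ((σ / ε) ^ (p / (p - 1))) ^ (1 / q) := by
          rw [hexp, Real.rpow_mul (by positivity)]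
      _ ≤ M * (c * W) ^ (1 / q) := by gcongr
      _ = M * (c ^ (1 / q) * W ^ (1 / q)) := by rw [Real.mul_rpow (by positivity) (by positivity)]
      _ ≤ M * (c * W ^ (1 / q)) := by
          gcongr
          exact Real.rpow_le_self_of_one_le hc (div_le_one_of_le₀ hq hq0.le)
      _ = c * (M * W ^ (1 / q)) := by ring
  unfold rate
  linarith

theorem exists_hasHardInstance_rate (hp : 1 < p) (hq : 1 ≤ q) (hL : 0 < L) (hΔ : 0 < Δ)
    (hσ : 0 ≤ σ) (hε : 0 < ε) (hεL : ε ≤ 1 / 12 * √(L * Δ)) (K : ℕ) :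
    ∃ d : ℕ, 1 ≤ d ∧ HasHardInstance.{u} p q L Δ σ ε d K
      ((4 ^ (p / (p - 1)))⁻¹ / 2050 * rate p q L Δ σ ε) := by
  have hLΔ : 0 < L * Δ := mul_pos hL hΔ
  have hε' : 144 * ε ^ 2 ≤ L * Δ := by
    have hsq := pow_le_pow_left₀ hε.le hεL 2
    rw [mul_pow, Real.sq_sqrt hLΔ.le] at hsq
    linarith
  obtain ⟨d, hd, h⟩ := exists_hasHardInstance_waitingTime (Δ := Δ) hp hq hL hσ hε
    (by linarith [sq_nonneg ε]) K
  refine ⟨d, hd, h.mono ?_⟩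
  rw [div_mul_eq_mul_div]
  gcongr
  rw [inv_mul_le_iff₀ (by positivity)]
  exact rate_le hp hq hLΔ.le hσ hε

end HardInstance

theorem rate_two_two (L Δ σ ε : ℝ) :
    rate 2 2 L Δ σ ε = σ ^ 2 / ε ^ 2 + L * Δ / ε ^ 2 + L * Δ * σ / ε ^ 3 := by
  have htwo : (2 : ℝ) / (2 - 1) = (2 : ℕ) := by norm_num
  have hone : (2 : ℝ) / (2 * (2 - 1)) = 1 := by norm_num
  rw [rate, htwo, hone, Real.rpow_natCast, Real.rpow_one]
  ring

end HeavyTail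

end

theorem theorem1_general :
    ∃ c₁ : ℝ, 0 < c₁ ∧ ∀ p : ℝ, 1 < p → ∃ c : ℝ, 0 < c ∧
      ∀ q : ℝ, 1 ≤ q → ∀ (K : ℕ) (L Δ σ ε : ℝ), 0 < L → 0 < Δ → 0 ≤ σ → 0 < ε →
        ε ≤ c₁ * Real.sqrt (L * Δ) →
        (ENNReal.ofReal (c * HeavyTail.rate p q L Δ σ ε)
            ≤ (HeavyTail.complexity.{u} p q K L Δ σ ε : ℝ≥0∞)) ∧
        (∃ d : ℕ, 1 ≤ d ∧ ∃ F ∈ HeavyTail.FunctionClass d Δ,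
          ∃ O ∈ HeavyTail.OracleClass F p q L σ,
          ∀ A : HeavyTail.Algorithm.{u} d K, A.IsZeroRespecting →
            ENNReal.ofReal (c * HeavyTail.rate p q L Δ σ ε)
              ≤ (A.roundsToStationary O ε : ℝ≥0∞)) ∧
        (p = 2 → q = 2 →
          ENNReal.ofReal (c * (σ ^ 2 / ε ^ 2 + L * Δ / ε ^ 2 + L * Δ * σ / ε ^ 3))
            ≤ (HeavyTail.complexity.{u} p q K L Δ σ ε : ℝ≥0∞)) := by
  refine ⟨1 / 12, by norm_num, fun p hp => ⟨(4 ^ (p / (p - 1)))⁻¹ / 2050, by positivity, ?_⟩⟩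
  intro q hq K L Δ σ ε hL hΔ hσ hε hεL
  obtain ⟨d, hd, h⟩ := HeavyTail.exists_hasHardInstance_rate.{u} hp hq hL hΔ hσ hε hεL K
  have hcomplexity := h.le_complexity hd
  refine ⟨hcomplexity, ⟨d, hd, h⟩, ?_⟩
  rintro rfl rfl
  rwa [HeavyTail.rate_two_two] at hcomplexity

theorem theorem1 :
    ∃ c₁ : ℝ, 0 < c₁ ∧ ∀ p : ℝ, 1 < p → p ≤ 2 → ∃ c : ℝ, 0 < c ∧
      ∀ q : ℝ, 1 ≤ q → q ≤ 2 → ∀ K : ℕ, 1 ≤ K →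
      ∀ L Δ σ ε : ℝ, 0 < L → 0 < Δ → 0 ≤ σ → 0 < ε → ε ≤ c₁ * Real.sqrt (L * Δ) →
        (ENNReal.ofReal (c * HeavyTail.rate p q L Δ σ ε)
            ≤ (HeavyTail.complexity.{u} p q K L Δ σ ε : ℝ≥0∞)) ∧
        (∃ d : ℕ, 1 ≤ d ∧ ∃ F ∈ HeavyTail.FunctionClass d Δ,
          ∃ O ∈ HeavyTail.OracleClass F p q L σ,
          ∀ A : HeavyTail.Algorithm.{u} d K, A.IsZeroRespecting →
            ENNReal.ofReal (c * HeavyTail.rate p q L Δ σ ε)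
              ≤ (A.roundsToStationary O ε : ℝ≥0∞)) ∧
        (p = 2 → q = 2 →
          ENNReal.ofReal (c * (σ ^ 2 / ε ^ 2 + L * Δ / ε ^ 2 + L * Δ * σ / ε ^ 3))
            ≤ (HeavyTail.complexity.{u} p q K L Δ σ ε : ℝ≥0∞)) := by
  obtain ⟨c₁, hc₁, h⟩ := theorem1_general.{u}
  exact ⟨c₁, hc₁, fun p hp _ => (h p hp).imp fun c ⟨hc, hb⟩ =>
    ⟨hc, fun q hq _ K _ => hb q hq K⟩⟩
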